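/- Let $\Sigma$ be a finite alphabet with $|\Sigma|\ge 2$, let $(X,Y,Z)$ be random variables with values in $\Sigma$, and let $\varepsilon,\delta\in(0,1]$. For a probability mass function $P$ on $\Sigma^3$ write $$I_P=\sum_{x,y,z\in\Sigma}P(x,y,z)\log\frac{P(x,y,z)\,P(z)}{P(x,z)\,P(y,z)}$$ (natural logarithm; $P(z),P(x,z),P(y,z)$ are the marginals; terms with $P(x,y,z)=0$ are $0$). Let $I(X;Y\mid Z)=I_P$ for the joint law $P$ of $(X,Y,Z)$, and let $I(\hat X;\hat Y\mid\hat Z)=I_{\hat P}$ where $\hat P$ is the empirical distribution of $N$ i.i.d. samples of $(X,Y,Z)$. If $$N\;\ge\;6.48\times10^6\cdot\frac{|\Sigma|^3\left(\log\frac{|\Sigma|}{\varepsilon\delta}+\log(7.2\times10^5)\right)\cdot\log\frac{12|\Sigma|^2}{\delta}}{\varepsilon},$$ then with probability at least $1-\delta$ the following both hold: 1. if $I(X;Y\mid Z)=0$, then $I(\hat X;\hat Y\mid\hat Z)\le\frac1{400}\,\varepsilon$; 2. if $I(X;Y\mid Z)\ge\varepsilon$, then $I(\hat X;\hat Y\mid\hat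 Z)\ge\frac1{400}\,I(X;Y\mid Z)$. -/

import Mathlib

open MeasureTheory ProbabilityTheory

namespace CMITester

/-- Conditional mutual information `I(X; Y | Z)` (natural logarithm) of a triple `(X, Y, Z)` whose
joint probability mass function is `p`:
`∑ p(x,y,z) log (p(x,y,z) p(z) / (p(x,z) p(y,z)))`,
with the marginals `p(z)`, `p(x,z)`, `p(y,z)` written as sums.
When `p` is a probability mass function and `p(x,y,z) > 0`, the three marginals are positive;
when `p(x,y,z) = 0`, the term is `0`, the usual convention `0 log 0 = 0`. -/
noncomputable def condMI {α β γ : Type*} [Fintype α] [Fintype β] [Fintype γ]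
    (p : α × β × γ → ℝ) : ℝ :=
  ∑ x, ∑ y, ∑ z, p (x, y, z) *
    Real.log (p (x, y, z) * (∑ x', ∑ y', p (x', y', z)) /
      ((∑ y', p (x, y', z)) * (∑ x', p (x', y, z))))

/-- The probability mass function of the random element `T` under `μ`. -/
noncomputable def pmfOf {Ω α : Type*} [MeasurableSpace Ω] (T : Ω → α) (μ : Measure Ω) : α → ℝ :=
  fun a => μ.real {ω | T ω = a}

/-- The probability mass function of the empirical distribution of the sample `s 0, …, s (N-1)`:
the fraction of sample points equal to `a`. -/
noncomputable def empiricalPMF {α : Type*} [DecidableEq α] {N : ℕ} (s : Fin N → α) : α → ℝ :=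
  fun a => ((Finset.univ.filter fun i => s i = a).card : ℝ) / N

end CMITester

/-! ### Pointwise divergence against Hellinger distance -/

namespace CMITester

/-! Work with square roots of masses. If u, α, β, γ are those of (x,y,z), (x,z), (y,z), z, and v =
αβ/γ, then the information is a sum of nonnegative terms `klTerm (u^2) (v^2)`
(`condMI_eq_sum_klTerm`). On this scale Chernoff's bound is uniform: an empirical root is off by
more than s with probability at most 2 exp(-N s²), whatever the mass
(`measureReal_abs_sqrt_sub_sqrt_le`). A union bound makes all roots s-close, hence each v is
3s-close. The rest is termwise. When u/v is bounded, a term is comparable to (u - v)², which is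
stable under such shifts; otherwise it is either of order s² log(1/s²) or has u so large that all
roots move by a small relative amount (`IsRootMass.klTerm_le_of_eq`, `IsRootMass.klTerm_sub_le`).
The total error k³ s² log(1/s²), with k the alphabet size, is a small multiple of ε for s² =
ε/(3.24·10⁶ k³ L), L being the sum of logarithms in the sample bound. -/

/-- The pointwise contribution `p log (p / q) - p + q` to the Kullback-Leibler divergence. -/
noncomputable def klTerm (p q : ℝ) : ℝ := p * Real.log (p / q) - p + q

theorem sq_mul_log_sq_div_sq (u v : ℝ) :
    u ^ 2 * Real.log (u ^ 2 / v ^ 2) = 2 * u ^ 2 * Real.log (u / v) := by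
  rw [← div_pow, Real.log_pow]; push_cast; ring

/-- The squared Hellinger distance bounds the divergence from below, term by term. -/
theorem sq_sub_le_klTerm {u v : ℝ} (hu : 0 ≤ u) (hv : 0 ≤ v) (huv : v = 0 → u = 0) :
    (u - v) ^ 2 ≤ klTerm (u ^ 2) (v ^ 2) := by
  rcases hv.eq_or_lt with rfl | hv
  · simp [huv rfl, klTerm]
  rcases hu.eq_or_lt with rfl | hu
  · simp [klTerm]
  have h := Real.one_sub_inv_le_log_of_pos (div_pos hu hv)
  have h2 : 2 * u ^ 2 * (1 - (u / v)⁻¹) = 2 * u ^ 2 - 2 * u * v := by field_simp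
  rw [klTerm, sq_mul_log_sq_div_sq]
  nlinarith [mul_le_mul_of_nonneg_left h (by positivity : 0 ≤ 2 * u ^ 2)]

theorem klTerm_nonneg {u v : ℝ} (hu : 0 ≤ u) (hv : 0 ≤ v) (huv : v = 0 → u = 0) :
    0 ≤ klTerm (u ^ 2) (v ^ 2) :=
  (sq_nonneg _).trans (sq_sub_le_klTerm hu hv huv)

/-- Converse to the Hellinger bound at bounded ratio, from log x ≤ x - 1 at x = u/v. -/
theorem klTerm_le_mul_sq_sub {u v R : ℝ} (hu : 0 ≤ u) (hv : 0 ≤ v) (h : u ≤ R * v) :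
    klTerm (u ^ 2) (v ^ 2) ≤ (2 * R + 1) * (u - v) ^ 2 := by
  rcases hv.eq_or_lt with rfl | hv
  · have : u = 0 := by linarith
    simp [this, klTerm]
  have hR : u / v ≤ R := (div_le_iff₀ hv).2 h
  have key : klTerm (u ^ 2) (v ^ 2) ≤ (2 * (u / v) + 1) * (u - v) ^ 2 := by
    rcases hu.eq_or_lt with rfl | hu
    · simp [klTerm]
    have h := Real.log_le_sub_one_of_pos (div_pos hu hv)
    have h2 : 2 * u ^ 2 * (u / v - 1) - u ^ 2 + v ^ 2 = (2 * (u / v) + 1) * (u - v) ^ 2 := by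
      field_simp; ring
    rw [klTerm, sq_mul_log_sq_div_sq, ← h2]
    nlinarith [mul_le_mul_of_nonneg_left h (by positivity : 0 ≤ 2 * u ^ 2)]
  exact key.trans (by gcongr)

theorem mul_log_one_div_le {x τ : ℝ} (hx : 0 ≤ x) (hτ : 0 < τ) :
    x * Real.log (1 / x) ≤ τ + x * Real.log (1 / τ) := by
  rcases hx.eq_or_lt with rfl | hx
  · simpa using hτ.le
  have h := Real.log_le_sub_one_of_pos (div_pos hτ hx)
  rw [Real.log_div hτ.ne' hx.ne'] at h
  have h2 : x * (τ / x - 1) = τ - x := by field_simp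
  simp only [one_div, Real.log_inv]
  nlinarith [mul_le_mul_of_nonneg_left h hx.le]

/-! ### Stability of a single term -/

/-- Square roots `u, α, β, γ` of the masses of `(x, y, z)`, `(x, z)`, `(y, z)` and `z`. -/
structure IsRootMass (u α β γ : ℝ) : Prop where
  nonneg : 0 ≤ u
  le_left : u ≤ α
  le_right : u ≤ β
  left_le : α ≤ γ
  right_le : β ≤ γ
  le_one : γ ≤ 1

namespace IsRootMass

variable {u α β γ u' α' β' γ' s τ : ℝ}

theorem left_nonneg (h : IsRootMass u α β γ) : 0 ≤ α := h.nonneg.trans h.le_left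

theorem right_nonneg (h : IsRootMass u α β γ) : 0 ≤ β := h.nonneg.trans h.le_right

theorem cond_nonneg (h : IsRootMass u α β γ) : 0 ≤ γ := h.left_nonneg.trans h.left_le

theorem prod_nonneg (h : IsRootMass u α β γ) : 0 ≤ α * β / γ :=
  div_nonneg (mul_nonneg h.left_nonneg h.right_nonneg) h.cond_nonneg

theorem eq_zero_of_prod (h : IsRootMass u α β γ) (h0 : α * β / γ = 0) : u = 0 := by
  have h1 := h.nonneg
  have h2 := h.le_left
  have h3 := h.le_right
  have h4 := h.left_le
  rcases div_eq_zero_iff.1 h0 with h5 | h5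
  · rcases mul_eq_zero.1 h5 with h6 | h6 <;> linarith
  · linarith

theorem klTerm_nonneg (h : IsRootMass u α β γ) : 0 ≤ klTerm (u ^ 2) ((α * β / γ) ^ 2) :=
  CMITester.klTerm_nonneg h.nonneg h.prod_nonneg h.eq_zero_of_prod

/-- The term of the divergence at a point of mass `u ^ 2` exceeding the product mass. -/
theorem klTerm_le (h : IsRootMass u α β γ) (hτ : 0 < τ) (hle : α * β / γ ≤ u) :
    klTerm (u ^ 2) ((α * β / γ) ^ 2) ≤ τ + u ^ 2 * Real.log (1 / τ) := by
  refine le_trans ?_ (mul_log_one_div_le (sq_nonneg u) hτ)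
  have hsq : (α * β / γ) ^ 2 ≤ u ^ 2 := pow_le_pow_left₀ h.prod_nonneg hle 2
  rcases h.nonneg.eq_or_lt with h0 | h0
  · rw [klTerm, ← h0]
    rw [← h0] at hsq
    simp only [ne_eq, OfNat.ofNat_ne_zero, not_false_eq_true, zero_pow, zero_mul] at hsq ⊢
    linarith
  have hα := h0.trans_le h.le_left
  have hβ := h0.trans_le h.le_right
  have hγ := hα.trans_le h.left_le
  -- This is u²γ ≤ αβ, from u ≤ α, u ≤ β and γ ≤ 1.
  have h1 : u ^ 2 / (α * β / γ) ^ 2 ≤ 1 / u ^ 2 := by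
    rw [div_le_div_iff₀ (by positivity) (by positivity), one_mul, ← mul_pow]
    refine pow_le_pow_left₀ (by positivity) ?_ 2
    rw [le_div_iff₀ hγ]
    calc u * u * γ ≤ α * β * 1 := by
          gcongr
          exacts [h.le_left, h.le_right, h.le_one]
      _ = α * β := mul_one _
  have h2 := Real.log_le_log (by positivity) h1
  rw [klTerm]
  nlinarith [mul_le_mul_of_nonneg_left h2 (sq_nonneg u)]

/-- The difference telescopes into three increments, each multiplied by conditional ratios such as
α/γ that are at most 1. -/
theorem abs_prod_sub_le (h : IsRootMass u α β γ) (h' : IsRootMass u' α' β' γ')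
    (hα : |α' - α| ≤ s) (hβ : |β' - β| ≤ s) (hγ : |γ' - γ| ≤ s) :
    |α' * β' / γ' - α * β / γ| ≤ 3 * s := by
  have hs : 0 ≤ s := (abs_nonneg _).trans hα
  have key : ∀ {a b c a' b' c' : ℝ}, 0 ≤ a → a ≤ c → 0 ≤ b' → b' ≤ c' → 0 ≤ b → b ≤ c →
      0 ≤ c → 0 ≤ c' → 0 ≤ a' → a' ≤ c' → |a' - a| ≤ s → |b' - b| ≤ s → |c' - c| ≤ s →
      |a' * b' / c' - a * b / c| ≤ 3 * s := by
    intro a b c a' b' c' ha hac hb' hbc' hb hbc hc hc' ha' hac' h1 h2 h3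
    rw [abs_le] at h1 h2 h3
    -- For a vanishing denominator the quotient is 0 by convention, and the other one is at most its
    -- own denominator, hence at most s.
    rcases hc.eq_or_lt with rfl | hc
    · have e1 : 0 ≤ a' * b' / c' := by positivity
      have e2 : a' * b' / c' ≤ c' := by
        rcases hc'.eq_or_lt with rfl | hc'
        · simp
        rw [div_le_iff₀ hc']; gcongr
      simp only [div_zero, sub_zero]
      rw [abs_of_nonneg e1]
      linarith
    rcases hc'.eq_or_lt with rfl | hc'
    · have e1 : 0 ≤ a * b / c := by positivity
      have e2 : a * b / c ≤ c := by
        rw [div_le_iff₀ hc]; gcongr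
      simp only [div_zero, zero_sub, abs_neg]
      rw [abs_of_nonneg e1]
      linarith
    have e : a' * b' / c' - a * b / c
        = (a' - a) * (b' / c') + a / c * (b' - b) + a / c * (b' / c') * (c - c') := by
      field_simp; ring
    have hx : |b' / c'| ≤ 1 := by
      rw [abs_of_nonneg (by positivity)]; exact (div_le_one hc').2 hbc'
    have hy : |a / c| ≤ 1 := by
      rw [abs_of_nonneg (by positivity)]; exact (div_le_one hc).2 hac
    rw [e]
    have t1 : |(a' - a) * (b' / c')| ≤ s * 1 := by
      rw [abs_mul]; gcongr; exact abs_le.2 h1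
    have t2 : |a / c * (b' - b)| ≤ 1 * s := by
      rw [abs_mul]; gcongr; exact abs_le.2 h2
    have t3 : |a / c * (b' / c') * (c - c')| ≤ 1 * 1 * s := by
      rw [abs_mul, abs_mul]; gcongr; rw [abs_sub_comm]; exact abs_le.2 h3
    have := abs_add_three ((a' - a) * (b' / c')) (a / c * (b' - b))
      (a / c * (b' / c') * (c - c'))
    linarith
  exact key h.left_nonneg h.left_le h'.right_nonneg h'.right_le h.right_nonneg h.right_le
    h.cond_nonneg h'.cond_nonneg h'.left_nonneg h'.left_le hα hβ hγ

/-- If the mass equals the product mass, then the perturbed term is small. -/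
theorem klTerm_le_of_eq (h : IsRootMass u α β γ) (h' : IsRootMass u' α' β' γ')
    (hu : |u' - u| ≤ s) (hα : |α' - α| ≤ s) (hβ : |β' - β| ≤ s) (hγ : |γ' - γ| ≤ s)
    (hs : 0 < s) (hℓ : 1 ≤ Real.log (1 / s ^ 2)) (heq : u = α * β / γ) :
    klTerm (u' ^ 2) ((α' * β' / γ') ^ 2) ≤ 81 * (s ^ 2 * Real.log (1 / s ^ 2)) := by
  have hv := h.abs_prod_sub_le h' hα hβ hγ
  rw [← heq] at hv
  set v' := α' * β' / γ'
  have hv0 : 0 ≤ v' := h'.prod_nonneg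
  have hu0 := h'.nonneg
  rw [abs_le] at hv hu
  have hs2 : s ^ 2 ≤ s ^ 2 * Real.log (1 / s ^ 2) := le_mul_of_one_le_right (sq_nonneg s) hℓ
  by_cases hr : u' ≤ 2 * v'
  · have h1 := klTerm_le_mul_sq_sub hu0 hv0 hr
    have h2 : (u' - v') ^ 2 ≤ (4 * s) ^ 2 := sq_le_sq' (by linarith) (by linarith)
    nlinarith
  -- Here v' < u'/2 while u' - v' ≤ 4s, so u' < 8s.
  · push Not at hr
    have h1 : klTerm (u' ^ 2) (v' ^ 2) ≤ s ^ 2 + u' ^ 2 * Real.log (1 / s ^ 2) :=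
      h'.klTerm_le (pow_pos hs 2) (by change v' ≤ u'; linarith)
    have h2 : u' ^ 2 ≤ (8 * s) ^ 2 := sq_le_sq' (by linarith) (by linarith)
    have h3 := mul_le_mul_of_nonneg_right h2 (by linarith : 0 ≤ Real.log (1 / s ^ 2))
    linarith [sq_nonneg s]

/-- A term of the divergence survives perturbation up to a constant factor and a small error. -/
theorem klTerm_sub_le (h : IsRootMass u α β γ) (h' : IsRootMass u' α' β' γ')
    (hu : |u' - u| ≤ s) (hα : |α' - α| ≤ s) (hβ : |β' - β| ≤ s) (hγ : |γ' - γ| ≤ s)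
    (hs : 0 < s) (hℓ : 1 ≤ Real.log (1 / s ^ 2)) :
    klTerm (u ^ 2) ((α * β / γ) ^ 2) / 100 - 401 * (s ^ 2 * Real.log (1 / s ^ 2)) ≤
      klTerm (u' ^ 2) ((α' * β' / γ') ^ 2) := by
  have hv := h.abs_prod_sub_le h' hα hβ hγ
  have hk' := h'.klTerm_nonneg
  have hhel := sq_sub_le_klTerm h'.nonneg h'.prod_nonneg h'.eq_zero_of_prod
  have hs2 : s ^ 2 ≤ s ^ 2 * Real.log (1 / s ^ 2) := le_mul_of_one_le_right (sq_nonneg s) hℓ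
  have hs0 : 0 < s ^ 2 := pow_pos hs 2
  -- With R = 24 the factor 2R + 1 = 49, doubled in splitting the square, stays below 100.
  by_cases hr : u ≤ 24 * (α * β / γ)
  · have h1 := klTerm_le_mul_sq_sub h.nonneg h.prod_nonneg hr
    rw [abs_le] at hv hu
    set v := α * β / γ
    set v' := α' * β' / γ'
    have h2 : ((u - v) - (u' - v')) ^ 2 ≤ (4 * s) ^ 2 := sq_le_sq' (by linarith) (by linarith)
    have h3 : (u - v) ^ 2 ≤ 2 * (u' - v') ^ 2 + 2 * ((u - v) - (u' - v')) ^ 2 := by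
      nlinarith [sq_nonneg ((u' - v') - ((u - v) - (u' - v')))]
    nlinarith
  push Not at hr
  have hvu : α * β / γ ≤ u := by linarith [h.prod_nonneg]
  by_cases hsm : u ≤ 20 * s
  · have h1 := h.klTerm_le hs0 hvu
    have h2 : u ^ 2 ≤ (20 * s) ^ 2 := pow_le_pow_left₀ h.nonneg hsm 2
    have h3 := mul_le_mul_of_nonneg_right h2 (by linarith : 0 ≤ Real.log (1 / s ^ 2))
    linarith
  push Not at hsm
  have hu0 : 0 < u := by linarith
  have hα0 := hu0.trans_le h.le_left
  have hβ0 := hu0.trans_le h.le_right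
  have hγ0 := hα0.trans_le h.left_le
  have hv0 : 0 < α * β / γ := by positivity
  rw [abs_le] at hu hα hβ hγ
  have hle1 := h.le_left
  have hle2 := h.le_right
  have hle3 := h.left_le
  -- Since u > 20s and u is the smallest root, s is at most 1/20 of each root.
  have u1 : 19 / 20 * u ≤ u' := by linarith
  have a1 : α' ≤ 21 / 20 * α := by linarith
  have b1 : β' ≤ 21 / 20 * β := by linarith
  have c1 : 19 / 20 * γ ≤ γ' := by linarith
  have hu0' : 0 < u' := by linarith
  have hα0' : 0 < α' := by linarith
  have hβ0' : 0 < β' := by linarith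
  have hγ0' : 0 < γ' := by linarith
  have hv0' : 0 < α' * β' / γ' := by positivity
  have v1 : α' * β' / γ' ≤ 5 / 4 * (α * β / γ) := by
    calc α' * β' / γ' ≤ (21 / 20 * α) * (21 / 20 * β) / (19 / 20 * γ) := by gcongr
      _ = (441 / 380) * (α * β / γ) := by field_simp; norm_num
      _ ≤ _ := mul_le_mul_of_nonneg_right (by norm_num) hv0.le
  have hr' : 3 / 4 * (u / (α * β / γ)) ≤ u' / (α' * β' / γ') := by
    calc 3 / 4 * (u / (α * β / γ)) ≤ (19 / 25) * (u / (α * β / γ)) :=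
          mul_le_mul_of_nonneg_right (by norm_num) (by positivity)
      _ = (19 / 20 * u) / (5 / 4 * (α * β / γ)) := by field_simp; norm_num
      _ ≤ _ := by gcongr
  have hlog := Real.log_le_log (by positivity) hr'
  rw [Real.log_mul (by norm_num) (by positivity)] at hlog
  -- The logarithm of the ratio drops by at most 1/3, against a value of at least 2.
  have h34 := Real.one_sub_inv_le_log_of_pos (by norm_num : (0 : ℝ) < 3 / 4)
  norm_num at h34
  have h24 : 24 ≤ u / (α * β / γ) := (le_div_iff₀ hv0).2 hr.le
  have h2 : (2 : ℝ) ≤ Real.log (u / (α * β / γ)) := by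
    rw [Real.le_log_iff_exp_le (by positivity)]
    have := Real.exp_one_lt_d9
    have h0 := Real.exp_pos 1
    have : Real.exp 2 = Real.exp 1 * Real.exp 1 := by rw [← Real.exp_add]; norm_num
    nlinarith
  rw [klTerm, klTerm, sq_mul_log_sq_div_sq, sq_mul_log_sq_div_sq]
  set r := Real.log (u / (α * β / γ))
  set r' := Real.log (u' / (α' * β' / γ'))
  have hvsq : (α * β / γ) ^ 2 ≤ u ^ 2 := pow_le_pow_left₀ h.prod_nonneg hvu 2
  have husq : (19 / 20 * u) ^ 2 ≤ u' ^ 2 := pow_le_pow_left₀ (by linarith) u1 2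
  have e1 : (19 / 20 * u) ^ 2 * (2 * (r - 1 / 3) - 1) ≤ u' ^ 2 * (2 * r' - 1) := by
    gcongr <;> linarith
  have e2 : u ^ 2 * (2 * r / 100) ≤ u ^ 2 * (361 / 400 * (2 * (r - 1 / 3) - 1)) := by
    gcongr; linarith
  nlinarith [sq_nonneg (α' * β' / γ')]

end IsRootMass

end CMITester

namespace CMITester

/-! ### Chernoff's bound for square roots -/

section Chernoff

/-- The tilt log(w/u), half the optimal Poisson tilt log(w²/u²), makes the exponent per sample at
most (wu - u²) - (w² - wu) = -(w - u)². -/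
theorem exp_mul_bernoulli_mgf_pow_le {u w : ℝ} (hu : 0 < u) (hw : 0 < w) (hu1 : u ≤ 1) (N : ℕ) :
    Real.exp (-Real.log (w / u) * (N * w ^ 2)) *
      (1 + (Real.exp (Real.log (w / u)) - 1) * u ^ 2) ^ N ≤ Real.exp (-N * (w - u) ^ 2) := by
  have h1 : 1 + (Real.exp (Real.log (w / u)) - 1) * u ^ 2 ≤ Real.exp (w * u - u ^ 2) := by
    rw [Real.exp_log (div_pos hw hu)]
    have := Real.add_one_le_exp (w * u - u ^ 2)
    have e : (w / u - 1) * u ^ 2 = w * u - u ^ 2 := by field_simp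
    linarith
  have h0 : 0 ≤ 1 + (Real.exp (Real.log (w / u)) - 1) * u ^ 2 := by
    nlinarith [mul_pos (Real.exp_pos (Real.log (w / u))) (pow_pos hu 2)]
  have h2 : w ^ 2 - w * u ≤ Real.log (w / u) * w ^ 2 := by
    have h := Real.one_sub_inv_le_log_of_pos (div_pos hw hu)
    have e : (1 - (w / u)⁻¹) * w ^ 2 = w ^ 2 - w * u := by field_simp
    nlinarith [mul_le_mul_of_nonneg_right h (sq_nonneg w)]
  calc _ ≤ Real.exp (-Real.log (w / u) * (N * w ^ 2)) * Real.exp (w * u - u ^ 2) ^ N := by gcongr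
    _ = Real.exp (-Real.log (w / u) * (N * w ^ 2) + N * (w * u - u ^ 2)) := by
        rw [← Real.exp_nat_mul, Real.exp_add]
    _ ≤ _ := by
        apply Real.exp_le_exp.2
        nlinarith [mul_le_mul_of_nonneg_left h2 (Nat.cast_nonneg (α := ℝ) N)]

/-- Chernoff's bound for the frequency of successes, on the scale of square roots. -/
theorem measureReal_abs_sqrt_sub_sqrt_le {Ω : Type*} [MeasurableSpace Ω] (ν : Measure Ω)
    [IsProbabilityMeasure ν] {N : ℕ} (hN : 0 < N) (W : Fin N → Ω → ℝ)
    (hW : ∀ i, AEMeasurable (W i) ν) (hindep : iIndepFun W ν)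
    (h01 : ∀ i ω, W i ω ∈ Set.Icc (0 : ℝ) 1) {p : ℝ} (hp0 : 0 ≤ p) (hp1 : p ≤ 1) (hmgf : ∀ i t, mgf (W i) ν t = 1 + (Real.exp t - 1) * p) {s : ℝ} (hs : 0 < s) :
    ν.real {ω | s < |√((∑ i, W i ω) / N) - √p|} ≤ 2 * Real.exp (-N * s ^ 2) := by
  have hN' : (0 : ℝ) < N := by exact_mod_cast hN
  have hsum : ∀ t, mgf (∑ i, W i) ν t = (1 + (Real.exp t - 1) * p) ^ N := fun t => by
    rw [hindep.mgf_sum₀ hW]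
    simp [hmgf]
  have hint : ∀ t, Integrable (fun ω => Real.exp (t * (∑ i, W i) ω)) ν := fun t => by
    refine integrable_exp_mul_of_mem_Icc (a := 0) (b := N) ?_ (ae_of_all _ fun ω => ?_)
    · exact Finset.aemeasurable_sum _ fun i _ => hW i
    · rw [Finset.sum_apply]
      refine ⟨Finset.sum_nonneg fun i _ => (h01 i ω).1, ?_⟩
      calc ∑ i, W i ω ≤ ∑ _i : Fin N, (1 : ℝ) := Finset.sum_le_sum fun i _ => (h01 i ω).2
        _ = N := by simp
  have hu1 : √p ≤ 1 := Real.sqrt_le_one.2 hp1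
  have hpp := Real.sq_sqrt hp0
  have upper : ν.real {ω | N * (√p + s) ^ 2 ≤ (∑ i, W i) ω} ≤ Real.exp (-N * s ^ 2) := by
    -- At p = 0 the tilt log(w/u) is unavailable; the mgf is 1, and tilt 1 suffices.
    rcases (Real.sqrt_nonneg p).eq_or_lt with h0 | h0
    · have hp : p = 0 := by rw [← hpp, ← h0]; norm_num
      have := measure_ge_le_exp_mul_mgf (N * (√p + s) ^ 2) zero_le_one (hint 1)
      rw [hsum] at this
      simpa [hp] using this
    · have ht : 0 ≤ Real.log ((√p + s) / √p) :=
        Real.log_nonneg ((one_le_div h0).2 (by linarith))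
      refine (measure_ge_le_exp_mul_mgf (N * (√p + s) ^ 2) ht (hint _)).trans ?_
      have := exp_mul_bernoulli_mgf_pow_le h0 (w := √p + s) (by linarith) hu1 N
      rw [hpp, add_sub_cancel_left] at this
      rwa [hsum]
  have lower : s < √p →
      ν.real {ω | (∑ i, W i) ω ≤ N * (√p - s) ^ 2} ≤ Real.exp (-N * s ^ 2) := fun hsp => by
    have h0 : 0 < √p := hs.trans hsp
    have hw : 0 < √p - s := by linarith
    have ht : Real.log ((√p - s) / √p) ≤ 0 :=
      Real.log_nonpos (by positivity) ((div_le_one h0).2 (by linarith))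
    refine (measure_le_le_exp_mul_mgf (N * (√p - s) ^ 2) ht (hint _)).trans ?_
    have := exp_mul_bernoulli_mgf_pow_le h0 hw hu1 N
    rw [hpp, show (√p - s - √p) ^ 2 = s ^ 2 by ring] at this
    rwa [hsum]
  have hup : ∀ ω, s < √((∑ i, W i ω) / N) - √p → N * (√p + s) ^ 2 ≤ (∑ i, W i) ω := by
    intro ω hω
    have h : √p + s < √((∑ i, W i ω) / N) := by linarith
    rw [Real.lt_sqrt (by positivity), lt_div_iff₀ hN'] at h
    rw [Finset.sum_apply]
    linarith
  have hlow : ∀ ω, s < √p - √((∑ i, W i ω) / N) →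
      s < √p ∧ (∑ i, W i) ω ≤ N * (√p - s) ^ 2 := by
    intro ω hω
    have h : √((∑ i, W i ω) / N) < √p - s := by linarith
    have h0 := (Real.sqrt_nonneg ((∑ i, W i ω) / N)).trans_lt h
    refine ⟨by linarith, ?_⟩
    rw [Real.sqrt_lt' h0, div_lt_iff₀ hN'] at h
    rw [Finset.sum_apply]
    linarith
  rw [two_mul]
  by_cases hsp : s < √p
  · refine le_trans (measureReal_mono ?_) ((measureReal_union_le _ _).trans
      (add_le_add upper (lower hsp)))
    intro ω hω
    rcases lt_abs.1 (Set.mem_ofPred.1 hω) with h | h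
    · exact Or.inl (hup ω h)
    · exact Or.inr (hlow ω (by linarith)).2
  · refine le_trans (measureReal_mono ?_) (upper.trans (le_add_of_nonneg_left (Real.exp_pos _).le))
    intro ω hω
    rcases lt_abs.1 (Set.mem_ofPred.1 hω) with h | h
    · exact hup ω h
    · exact absurd (hlow ω (by linarith)).1 hsp

end Chernoff

/-! ### Empirical masses of sets -/

section Mass

theorem sum_empiricalPMF {T : Type*} [DecidableEq T] {N : ℕ} (s : Fin N → T) (B : Finset T) :
    ∑ t ∈ B, empiricalPMF s t = (∑ i, if s i ∈ B then (1 : ℝ) else 0) / N := by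
  simp only [empiricalPMF, ← Finset.sum_div, Finset.card_filter, Nat.cast_sum]
  rw [Finset.sum_comm]
  simp

theorem empiricalPMF_nonneg {T : Type*} [DecidableEq T] {N : ℕ} (s : Fin N → T) (t : T) :
    0 ≤ empiricalPMF s t := by
  unfold empiricalPMF; positivity

variable {T : Type*} [Fintype T]

theorem sum_univ_empiricalPMF [DecidableEq T] {N : ℕ} (hN : 0 < N) (s : Fin N → T) :
    ∑ t, empiricalPMF s t = 1 := by
  have : (N : ℝ) ≠ 0 := by positivity
  simp [sum_empiricalPMF, this]

theorem pmfOf_nonneg {T Ω : Type*} [MeasurableSpace Ω] (μ : Measure Ω) (Y : Ω → T) (t : T) :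
    0 ≤ pmfOf Y μ t := measureReal_nonneg

variable [MeasurableSpace T] [MeasurableSingletonClass T]
  {Ω : Type*} [MeasurableSpace Ω] (μ : Measure Ω) [IsProbabilityMeasure μ]
  {Y : Ω → T}

theorem integral_comp_eq_sum_pmfOf (hY : Measurable Y) (f : T → ℝ) :
    ∫ ω, f (Y ω) ∂μ = ∑ t, pmfOf Y μ t * f t := by
  have : IsProbabilityMeasure (μ.map Y) := Measure.isProbabilityMeasure_map hY.aemeasurable
  rw [← integral_map hY.aemeasurable (measurable_of_finite f).aestronglyMeasurable,
    integral_fintype Integrable.of_finite]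
  refine Finset.sum_congr rfl fun t _ => ?_
  rw [map_measureReal_apply hY (measurableSet_singleton t), smul_eq_mul]
  rfl

theorem sum_pmfOf (hY : Measurable Y) : ∑ t, pmfOf Y μ t = 1 := by
  simpa using (integral_comp_eq_sum_pmfOf μ hY fun _ => 1).symm

theorem mgf_indicator [DecidableEq T] (hY : Measurable Y) (B : Finset T) (t : ℝ) :
    mgf (fun ω => if Y ω ∈ B then (1 : ℝ) else 0) μ t
      = 1 + (Real.exp t - 1) * ∑ a ∈ B, pmfOf Y μ a := by
  have h : ∀ a, pmfOf Y μ a * Real.exp (t * if a ∈ B then (1 : ℝ) else 0)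
      = pmfOf Y μ a + (Real.exp t - 1) * if a ∈ B then pmfOf Y μ a else 0 := fun a => by
    split_ifs
    · rw [mul_one]; ring
    · simp
  rw [mgf, integral_comp_eq_sum_pmfOf μ hY fun a => Real.exp (t * if a ∈ B then (1 : ℝ) else 0)]
  simp only [h, Finset.sum_add_distrib, ← Finset.mul_sum, sum_pmfOf μ hY, Finset.sum_ite_mem,
    Finset.univ_inter]

/-- Concentration of the empirical mass of a set of values. -/
theorem measureReal_abs_sqrt_mass_sub_le [DecidableEq T] (hY : Measurable Y)
    {Ω' : Type*} [MeasurableSpace Ω'] (ν : Measure Ω') [IsProbabilityMeasure ν] {N : ℕ} (hN : 0 < N) (S : Fin N → Ω' → T) (hindep : iIndepFun S ν)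
    (hident : ∀ i, IdentDistrib (S i) Y ν μ) (B : Finset T) {s : ℝ} (hs : 0 < s) :
    ν.real {ω | s < |√(∑ t ∈ B, empiricalPMF (fun i => S i ω) t) - √(∑ t ∈ B, pmfOf Y μ t)|}
      ≤ 2 * Real.exp (-N * s ^ 2) := by
  have hg : Measurable fun t : T => if t ∈ B then (1 : ℝ) else 0 := measurable_of_finite _
  simp only [sum_empiricalPMF]
  refine measureReal_abs_sqrt_sub_sqrt_le ν hN (fun i ω => if S i ω ∈ B then (1 : ℝ) else 0)
    (fun i => hg.comp_aemeasurable (hident i).aemeasurable_fst)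
    (hindep.comp (fun _ t => if t ∈ B then (1 : ℝ) else 0) fun _ => hg)
    (fun i ω => ?_) (Finset.sum_nonneg fun t _ => pmfOf_nonneg μ Y t) ?_ (fun i t => ?_) hs
  · split_ifs <;> simp
  · rw [← sum_pmfOf μ hY]
    exact Finset.sum_le_sum_of_subset_of_nonneg (Finset.subset_univ _)
      fun t _ _ => pmfOf_nonneg μ Y t
  · rw [← mgf_indicator μ hY]
    exact congrFun (mgf_congr_identDistrib ((hident i).comp hg)) t

end Mass

end CMITester

namespace CMITester

/-! ### Conditional mutual information as a sum of terms -/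

section Decomposition

variable {A : Type*} [Fintype A]

/-- The values sharing with `t = (x, y, z)` all coordinates, `(x, z)`, `(y, z)`, or `z`. -/
def marginalSet (t : A × A × A) : Fin 4 → Finset (A × A × A) :=
  ![{t.1} ×ˢ {t.2.1} ×ˢ {t.2.2}, {t.1} ×ˢ Finset.univ ×ˢ {t.2.2},
    Finset.univ ×ˢ {t.2.1} ×ˢ {t.2.2}, Finset.univ ×ˢ Finset.univ ×ˢ {t.2.2}]

/-- The square root of the mass of `marginalSet t j`. -/
noncomputable def rootMass (p : A × A × A → ℝ) (t : A × A × A) (j : Fin 4) : ℝ :=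
  √(∑ a ∈ marginalSet t j, p a)

variable {p p' : A × A × A → ℝ}

theorem isRootMass_rootMass (hp : ∀ t, 0 ≤ p t) (hp1 : ∑ t, p t = 1) (t : A × A × A) :
    IsRootMass (rootMass p t 0) (rootMass p t 1) (rootMass p t 2) (rootMass p t 3) := by
  have mono : ∀ i j, marginalSet t i ⊆ marginalSet t j → rootMass p t i ≤ rootMass p t j :=
    fun i j h => Real.sqrt_le_sqrt (Finset.sum_le_sum_of_subset_of_nonneg h fun a _ _ => hp a)
  refine ⟨Real.sqrt_nonneg _, mono _ _ ?_, mono _ _ ?_, mono _ _ ?_, mono _ _ ?_, ?_⟩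
  iterate 4
    intro a
    simp only [marginalSet, Matrix.cons_val, Finset.mem_product, Finset.mem_singleton,
      Finset.mem_univ]
    tauto
  exact Real.sqrt_le_one.2 (hp1 ▸ Finset.sum_le_sum_of_subset_of_nonneg (Finset.subset_univ _)
    fun a _ _ => hp a)

/-- Conditional mutual information as a sum of nonnegative terms. -/
theorem condMI_eq_sum_klTerm (hp : ∀ t, 0 ≤ p t) :
    condMI p = ∑ t, klTerm (rootMass p t 0 ^ 2)
      ((rootMass p t 1 * rootMass p t 2 / rootMass p t 3) ^ 2) := by
  have hsq : ∀ t j, rootMass p t j ^ 2 = ∑ a ∈ marginalSet t j, p a :=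
    fun t j => Real.sq_sqrt (Finset.sum_nonneg fun a _ => hp a)
  -- The product masses have the same total as `p`, so the corrections -p + q in `klTerm` cancel.
  have hprod : ∑ x, ∑ y, ∑ z, (∑ y', p (x, y', z)) * (∑ x', p (x', y, z)) /
      (∑ x', ∑ y', p (x', y', z)) = ∑ x, ∑ y, ∑ z, p (x, y, z) := by
    have e : ∀ f : A → A → A → ℝ, ∑ x, ∑ y, ∑ z, f x y z = ∑ z, ∑ x, ∑ y, f x y z := fun f => by
      rw [Finset.sum_comm_cycle]
    refine (e _).trans (Eq.trans ?_ (e _).symm)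
    refine Finset.sum_congr rfl fun z _ => ?_
    simp only [← Finset.sum_div, ← Finset.mul_sum, ← Finset.sum_mul]
    rw [Finset.sum_comm (f := fun y x' => p (x', y, z)), mul_self_div_self]
  simp only [klTerm, div_pow, mul_pow, hsq, Fintype.sum_prod_type]
  simp only [marginalSet, Matrix.cons_val, Finset.sum_product, Finset.sum_singleton,
    Finset.sum_add_distrib, Finset.sum_sub_distrib, hprod, condMI, div_div_eq_mul_div]
  ring

theorem condMI_le_of_condMI_eq_zero (hp : ∀ t, 0 ≤ p t) (hp1 : ∑ t, p t = 1)
    (hp' : ∀ t, 0 ≤ p' t) (hp1' : ∑ t, p' t = 1) {s : ℝ} (hs : 0 < s)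
    (hℓ : 1 ≤ Real.log (1 / s ^ 2)) (hclose : ∀ t j, |rootMass p' t j - rootMass p t j| ≤ s)
    (h0 : condMI p = 0) :
    condMI p' ≤ 81 * ((Fintype.card A : ℝ) ^ 3 * (s ^ 2 * Real.log (1 / s ^ 2))) := by
  rw [condMI_eq_sum_klTerm hp, Finset.sum_eq_zero_iff_of_nonneg
    fun t _ => (isRootMass_rootMass hp hp1 t).klTerm_nonneg] at h0
  rw [condMI_eq_sum_klTerm hp']
  have : ∀ t ∈ Finset.univ, klTerm (rootMass p' t 0 ^ 2)
      ((rootMass p' t 1 * rootMass p' t 2 / rootMass p' t 3) ^ 2) ≤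
        81 * (s ^ 2 * Real.log (1 / s ^ 2)) := fun t ht => by
    have h := isRootMass_rootMass hp hp1 t
    refine h.klTerm_le_of_eq (isRootMass_rootMass hp' hp1' t) (hclose t 0) (hclose t 1)
      (hclose t 2) (hclose t 3) hs hℓ ?_
    have := sq_sub_le_klTerm h.nonneg h.prod_nonneg h.eq_zero_of_prod
    rw [h0 t ht] at this
    exact sub_eq_zero.1 (pow_eq_zero_iff two_ne_zero |>.1 (this.antisymm (sq_nonneg _)))
  refine (Finset.sum_le_card_nsmul _ _ _ this).trans_eq ?_
  simp [Fintype.card_prod]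
  ring

theorem condMI_sub_le (hp : ∀ t, 0 ≤ p t) (hp1 : ∑ t, p t = 1)
    (hp' : ∀ t, 0 ≤ p' t) (hp1' : ∑ t, p' t = 1) {s : ℝ} (hs : 0 < s)
    (hℓ : 1 ≤ Real.log (1 / s ^ 2)) (hclose : ∀ t j, |rootMass p' t j - rootMass p t j| ≤ s) :
    condMI p / 100 - 401 * ((Fintype.card A : ℝ) ^ 3 * (s ^ 2 * Real.log (1 / s ^ 2))) ≤
      condMI p' := by
  rw [condMI_eq_sum_klTerm hp, condMI_eq_sum_klTerm hp']
  refine le_trans (le_of_eq ?_) (Finset.sum_le_sum fun t _ =>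
    (isRootMass_rootMass hp hp1 t).klTerm_sub_le (isRootMass_rootMass hp' hp1' t) (hclose t 0)
      (hclose t 1) (hclose t 2) (hclose t 3) hs hℓ)
  rw [Finset.sum_sub_distrib, Finset.sum_div]
  simp [Fintype.card_prod]
  ring

end Decomposition

/-! ### Numerical choice of parameters -/

section Parameters

variable {k ε δ L : ℝ}

theorem two_le_log_const : 2 ≤ Real.log (7.2 * 10 ^ 5) := by
  rw [Real.le_log_iff_exp_le (by norm_num), show (2 : ℝ) = 1 + 1 by norm_num, Real.exp_add]
  nlinarith [Real.exp_one_lt_d9, Real.exp_pos 1]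

theorem log_const_le : Real.log (3.24 * 10 ^ 6) ≤ 3.5 + Real.log (7.2 * 10 ^ 5) := by
  rw [show (3.24 * 10 ^ 6 : ℝ) = 4.5 * (7.2 * 10 ^ 5) by norm_num,
    Real.log_mul (by norm_num) (by norm_num)]
  linarith [Real.log_le_sub_one_of_pos (show (0 : ℝ) < 4.5 by norm_num)]

/-- The factor L in the denominator of the threshold τ is there to absorb log(1/τ); in 4L, the
multiples of log k and -log ε dominate, and log L ≤ L - 1. -/
theorem log_inv_threshold_bounds (hk : 2 ≤ k) (hε : 0 < ε) (hε1 : ε ≤ 1) (hδ : 0 < δ)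
    (hδ1 : δ ≤ 1) (hL : L = Real.log (k / (ε * δ)) + Real.log (7.2 * 10 ^ 5)) :
    1 ≤ L ∧ 1 ≤ Real.log (1 / (ε / (3.24 * 10 ^ 6 * k ^ 3 * L))) ∧
      Real.log (1 / (ε / (3.24 * 10 ^ 6 * k ^ 3 * L))) ≤ 4 * L := by
  have ha := two_le_log_const
  have hk0 : 0 < k := by linarith
  have e : Real.log (k / (ε * δ)) = Real.log k - Real.log ε - Real.log δ := by
    rw [Real.log_div hk0.ne' (by positivity), Real.log_mul hε.ne' hδ.ne']; ring
  have lk : 0 ≤ Real.log k := Real.log_nonneg (by linarith)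
  have lε : Real.log ε ≤ 0 := Real.log_nonpos hε.le hε1
  have lδ : Real.log δ ≤ 0 := Real.log_nonpos hδ.le hδ1
  have hL1 : 1 ≤ L := by rw [hL, e]; linarith
  have lL : 0 ≤ Real.log L := Real.log_nonneg hL1
  have lL' : Real.log L ≤ L - 1 := Real.log_le_sub_one_of_pos (by linarith)
  have hc : Real.log (7.2 * 10 ^ 5) ≤ Real.log (3.24 * 10 ^ 6) :=
    Real.log_le_log (by norm_num) (by norm_num)
  have hc' := log_const_le
  have e2 : Real.log (1 / (ε / (3.24 * 10 ^ 6 * k ^ 3 * L)))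
      = Real.log (3.24 * 10 ^ 6) + 3 * Real.log k + Real.log L - Real.log ε := by
    rw [one_div_div, Real.log_div (by positivity) hε.ne', Real.log_mul (by positivity)
      (by positivity), Real.log_mul (by positivity) (by positivity), Real.log_pow]
    norm_num
  refine ⟨hL1, ?_, ?_⟩ <;> rw [e2] <;> linarith

/-- The squared ratio supplies k⁴ against the k³ of the event count, leaving δ²/(18k). -/
theorem union_bound_le (hk : 2 ≤ k) (hδ : 0 < δ) (hδ1 : δ ≤ 1) {x : ℝ}
    (hx : 2 * Real.log (12 * k ^ 2 / δ) ≤ x) : k ^ 3 * 4 * (2 * Real.exp (-x)) ≤ δ := by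
  have hk0 : 0 < k := by linarith
  have h1 : Real.exp (-x) ≤ (δ / (12 * k ^ 2)) ^ 2 := by
    calc Real.exp (-x) ≤ Real.exp (-(2 * Real.log (12 * k ^ 2 / δ))) :=
          Real.exp_le_exp.2 (by linarith)
      _ = (δ / (12 * k ^ 2)) ^ 2 := by
          rw [show -(2 * Real.log (12 * k ^ 2 / δ)) = ((2 : ℕ) : ℝ) * Real.log (δ / (12 * k ^ 2)) by
            rw [← inv_div, Real.log_inv]; push_cast; ring, Real.exp_nat_mul,
            Real.exp_log (by positivity)]
  calc k ^ 3 * 4 * (2 * Real.exp (-x)) ≤ k ^ 3 * 4 * (2 * (δ / (12 * k ^ 2)) ^ 2) := by gcongr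
    _ = δ * (δ / (18 * k)) := by field_simp; norm_num
    _ ≤ δ * 1 := by
        gcongr
        rw [div_le_one (by positivity)]; linarith
    _ = δ := mul_one δ

end Parameters

end CMITester

/-! ### The tester's guarantee -/

open CMITester in
theorem mainTheorem7
    {A : Type*} [Fintype A] [DecidableEq A] [MeasurableSpace A] [MeasurableSingletonClass A]
    (hA : 2 ≤ Fintype.card A)
    {Ω : Type*} [MeasurableSpace Ω] (μ : Measure Ω) [IsProbabilityMeasure μ]
    (X Y Z : Ω → A) (hX : Measurable X) (hY : Measurable Y) (hZ : Measurable Z)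
    (ε δ : ℝ) (hε : 0 < ε) (hε1 : ε ≤ 1) (hδ : 0 < δ) (hδ1 : δ ≤ 1)
    (N : ℕ)
    (hN : (N : ℝ) ≥ 6.48 * 10 ^ 6 *
      ((Fintype.card A : ℝ) ^ 3 *
        (Real.log ((Fintype.card A : ℝ) / (ε * δ)) + Real.log (7.2 * 10 ^ 5)) *
        Real.log (12 * (Fintype.card A : ℝ) ^ 2 / δ) / ε))
    {Ω' : Type*} [MeasurableSpace Ω'] (ν : Measure Ω') [IsProbabilityMeasure ν]
    (S : Fin N → Ω' → A × A × A)
    (hindep : iIndepFun S ν)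
    (hident : ∀ i, IdentDistrib (S i) (fun ω => (X ω, Y ω, Z ω)) ν μ) :
    ν.real {ω' |
      (CMITester.condMI (CMITester.pmfOf (fun ω => (X ω, Y ω, Z ω)) μ) = 0 →
        CMITester.condMI (CMITester.empiricalPMF fun i => S i ω') ≤ 1 / 400 * ε) ∧
      (CMITester.condMI (CMITester.pmfOf (fun ω => (X ω, Y ω, Z ω)) μ) ≥ ε →
        CMITester.condMI (CMITester.empiricalPMF fun i => S i ω') ≥
          1 / 400 * CMITester.condMI (CMITester.pmfOf (fun ω => (X ω, Y ω, Z ω)) μ))}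
      ≥ 1 - δ := by
  have hT : Measurable fun ω => (X ω, Y ω, Z ω) := hX.prodMk (hY.prodMk hZ)
  have hk : (2 : ℝ) ≤ Fintype.card A := by exact_mod_cast hA
  set k : ℝ := ((Fintype.card A : ℕ) : ℝ) with hkdef
  obtain ⟨L, hL⟩ : ∃ L, L = Real.log (k / (ε * δ)) + Real.log (7.2 * 10 ^ 5) := ⟨_, rfl⟩
  obtain ⟨hL1, hℓ, hℓ4⟩ := log_inv_threshold_bounds hk hε hε1 hδ hδ1 hL
  rw [← hL] at hN
  set p := pmfOf (fun ω => (X ω, Y ω, Z ω)) μ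
  set τ := ε / (3.24 * 10 ^ 6 * k ^ 3 * L) with hτdef
  have hk0 : 0 < k := by linarith
  have hτ : 0 < τ := by positivity
  have hlog : 0 < Real.log (12 * k ^ 2 / δ) :=
    Real.log_pos ((one_lt_div hδ).2 (by nlinarith))
  have hNpos : 0 < N := by
    have : (0 : ℝ) < N := lt_of_lt_of_le (by positivity) hN
    exact_mod_cast this
  -- The factor 2 is 6.48/3.24.
  have hNτ : 2 * Real.log (12 * k ^ 2 / δ) ≤ N * τ := by
    calc 2 * Real.log (12 * k ^ 2 / δ)
        = 6.48 * 10 ^ 6 * (k ^ 3 * L * Real.log (12 * k ^ 2 / δ) / ε) * τ := by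
          rw [hτdef]; field_simp; norm_num
      _ ≤ N * τ := by gcongr
  obtain ⟨s, hs, hsτ⟩ : ∃ s : ℝ, 0 < s ∧ s ^ 2 = τ :=
    ⟨√τ, Real.sqrt_pos.2 hτ, Real.sq_sqrt hτ.le⟩
  have herr : k ^ 3 * (τ * Real.log (1 / τ)) ≤ ε / 810000 := by
    calc k ^ 3 * (τ * Real.log (1 / τ)) ≤ k ^ 3 * (τ * (4 * L)) := by gcongr
      _ = ε / 810000 := by rw [hτdef]; field_simp; norm_num
  have hp : ∀ t, 0 ≤ p t := pmfOf_nonneg μ _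
  have hp1 : ∑ t, p t = 1 := sum_pmfOf μ hT
  set bad : Set Ω' := ⋃ i : (A × A × A) × Fin 4,
    {ω | s < |rootMass (empiricalPMF fun i => S i ω) i.1 i.2 - rootMass p i.1 i.2|} with hbad
  have hbadle : ν.real bad ≤ δ := by
    refine (measureReal_iUnion_fintype_le _).trans ?_
    refine (Finset.sum_le_card_nsmul _ _ (2 * Real.exp (-(N * τ))) fun i _ => ?_).trans ?_
    · rw [← neg_mul, ← hsτ]
      exact measureReal_abs_sqrt_mass_sub_le μ hT ν hNpos S hindep hident _ hs
    · refine le_trans (le_of_eq ?_) (union_bound_le hk hδ hδ1 hNτ)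
      simp [Fintype.card_prod, hkdef]
      ring
  set good : Set Ω' := {ω' | (condMI p = 0 →
        condMI (empiricalPMF fun i => S i ω') ≤ 1 / 400 * ε) ∧ (condMI p ≥ ε →
        condMI (empiricalPMF fun i => S i ω') ≥ 1 / 400 * condMI p)} with hgood
  have hcover : Set.univ ⊆ good ∪ bad := by
    intro ω _
    by_cases hω : ω ∈ bad
    · exact Or.inr hω
    left
    simp only [hbad, Set.mem_iUnion, Set.mem_ofPred_eq, not_exists, not_lt] at hω
    have hclose : ∀ t j, |rootMass (empiricalPMF fun i => S i ω) t j - rootMass p t j| ≤ s :=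
      fun t j => hω (t, j)
    rw [← hsτ] at hℓ herr
    have hp' := empiricalPMF_nonneg fun i => S i ω
    have hp1' := sum_univ_empiricalPMF hNpos fun i => S i ω
    -- The errors are 81ε/810000 ≤ ε/400 and 401ε/810000, the latter below (1/100 - 1/400)ε.
    refine ⟨fun h0 => ?_, fun hge => ?_⟩
    · have := condMI_le_of_condMI_eq_zero hp hp1 hp' hp1' hs hℓ hclose h0
      rw [← hkdef] at this
      linarith
    · have := condMI_sub_le hp hp1 hp' hp1' hs hℓ hclose
      rw [← hkdef] at this
      linarith
  have h1 : (1 : ℝ) ≤ ν.real good + ν.real bad := by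
    calc (1 : ℝ) = ν.real Set.univ := probReal_univ.symm
      _ ≤ _ := (measureReal_mono hcover).trans (measureReal_union_le _ _)
  linarith
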